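/- **Theorem 2.10.** Let $\mathcal{O}$ be a one-dimensional noetherian domain with field of fractions $K$ whose normalization $\tilde{\mathcal{O}}$ (the integral closure of $\mathcal{O}$ in $K$) is finitely generated as an $\mathcal{O}$-module; then $\tilde{\mathcal{O}}$ is a Dedekind domain. Let $\mathrm{Div}(\mathcal{O})$ be the free abelian group on the maximal ideals of $\mathcal{O}$. For a maximal ideal $\mathfrak{p}$ of $\mathcal{O}$ let $\mathrm{ord}_{\mathfrak{p}}\colon K^*\to\mathbb{Z}$ be the homomorphism $$\tfrac{a}{b}\mapsto \mathrm{len}_{\mathcal{O}_\mathfrak{p}}(\mathcal{O}_\mathfrak{p}/a\mathcal{O}_\mathfrak{p})-\mathrm{len}_{\mathcal{O}_\mathfrak{p}}(\mathcal{O}_\mathfrak{p}/b\mathcal{O}_\mathfrak{p}),$$ and let $\mathrm{Chow}(\mathcal{O})$ be the quotient of $\mathrm{Div}(\mathcal{O})$ by the subgroup of principal divisors $\sum_{\mathfrak{p}}\mathrm{ord}_{\mathfrak{p}}(a)\,\mathfrak{p}$, $a\in K^*$. For a nonzero fractional ideal $\mathfrak{A}=\prod_{\mathfrak{P}}\mathfrak{P}^{v_\mathfrak{P}(\mathfrak{A})}$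 of $\tilde{\mathcal{O}}$ put $\mathrm{div}(\mathfrak{A})=\sum_{\mathfrak{P}} v_{\mathfrak{P}}(\mathfrak{A})\,\mathfrak{P}\in\mathrm{Div}(\tilde{\mathcal{O}})$, and let $f_*\colon \mathrm{Div}(\tilde{\mathcal{O}})\to\mathrm{Div}(\mathcal{O})$ be the homomorphism with $\mathfrak{P}\mapsto [\tilde{\mathcal{O}}/\mathfrak{P}:\mathcal{O}/(\mathfrak{P}\cap\mathcal{O})]\cdot(\mathfrak{P}\cap\mathcal{O})$. Then $\mathcal{O}$ has only finitely many non-invertible maximal ideals $\mathfrak{p}_1,\dots,\mathfrak{p}_r$. For $1\le i\le r$ let $\mathfrak{P}_{i,1},\dots,\mathfrak{P}_{i,r_i}$ be the maximal ideals of $\tilde{\mathcal{O}}$ over $\mathfrak{p}_i$, let $d_{i,j}=[\tilde{\mathcal{O}}/\mathfrak{P}_{i,j}:\mathcal{O}/\mathfrak{p}_i]$ and $g_i=\gcd(d_{i,1},\dots,d_{i,r_i})$, let $\lambda_{i,j}$ be any integers with $\sum_{j}\lambda_{i,j}d_{i,j}=g_i$ for all $i$, and set $\mathfrak{Q}_i=\prod_{j}\mathfrak{P}_{i,j}^{\lambda_{i,j}}$.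 Let $$N=\big\langle\, [\mathfrak{Q}_i^{d_{i,j}/g_i}\,\mathfrak{P}_{i,j}^{-1}] \;:\; 1\le i\le r,\ 1\le j\le r_i \,\big\rangle\le \mathrm{Cl}(\tilde{\mathcal{O}}),\qquad G=\bigoplus_{i=1}^r\mathbb{Z}\,\mathfrak{p}_i\ \oplus\ \mathrm{Cl}(\tilde{\mathcal{O}})/N .$$ Then $$\varphi\colon G\to\mathrm{Chow}(\mathcal{O}),\qquad \Big(\sum_{i=1}^r a_i\mathfrak{p}_i,\ [\mathfrak{A}]\Big)\mapsto\Big[\sum_{i=1}^r a_i\mathfrak{p}_i+f_*(\mathrm{div}(\mathfrak{A}))\Big]$$ is a well-defined surjective group homomorphism, and its kernel is the subgroup $$R=\big\langle\, (g_i\mathfrak{p}_i,\ [\mathfrak{Q}_i^{-1}]) \;:\; 1\le i\le r \,\big\rangle\le G .$$ In particular, $G/R\cong\mathrm{Chow}(\mathcal{O})$. -/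

import Mathlib

open scoped nonZeroDivisors

/-- A commutative ring of Krull dimension exactly one. -/
class IsOneDimensional (R : Type*) [CommRing R] : Prop where
  ringKrullDim_eq_one : ringKrullDim R = 1

namespace OneDimDomain

section Basic

variable (R : Type*) [CommRing R]

instance [IsOneDimensional R] : Ring.KrullDimLE 1 R := by
  rw [Ring.KrullDimLE, Order.krullDimLE_iff]
  exact (IsOneDimensional.ringKrullDim_eq_one (R := R)).le

theorem not_isField [IsOneDimensional R] : ¬ IsField R := fun h => by
  have h1 := IsOneDimensional.ringKrullDim_eq_one (R := R)
  rw [ringKrullDim_eq_zero_of_isField h] at h1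
  exact zero_ne_one h1

variable [IsDomain R]

variable {R} in
theorem maximal_ne_bot [IsOneDimensional R] (p : MaximalSpectrum R) : p.asIdeal ≠ ⊥ :=
  Ring.ne_bot_of_isMaximal_of_not_isField p.isMaximal (not_isField R)

/-- A maximal ideal of a one-dimensional domain, as a nonzero prime ideal. -/
def toHeightOne [IsOneDimensional R] (p : MaximalSpectrum R) :
    IsDedekindDomain.HeightOneSpectrum R :=
  ⟨p.asIdeal, p.isMaximal.isPrime, maximal_ne_bot p⟩

end Basic

/-- The group of divisors: the free abelian group on the set of maximal ideals. -/
abbrev Divisors (R : Type*) [CommRing R] : Type _ := MaximalSpectrum R →₀ ℤ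

theorem krullDimLE_localization {R : Type*} [CommRing R] [IsOneDimensional R]
    (p : MaximalSpectrum R) :
    Ring.KrullDimLE 1 (Localization.AtPrime p.asIdeal) := by
  rw [Ring.KrullDimLE, Order.krullDimLE_iff]
  have h := IsLocalization.AtPrime.ringKrullDim_eq_height p.asIdeal
    (Localization.AtPrime p.asIdeal)
  have h2 := Ideal.height_le_ringKrullDim_of_ne_top (I := p.asIdeal) p.isMaximal.ne_top
  rw [← h, IsOneDimensional.ringKrullDim_eq_one (R := R)] at h2
  exact h2

section Divisors

variable (R : Type*) [CommRing R] [IsDomain R] [IsNoetherianRing R] [IsOneDimensional R]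
variable (K : Type*) [Field K] [Algebra R K] [IsFractionRing R K]

variable {R}

/-- For `a` in `R` nonzero this is `exp (len (R_p / a R_p))`, and `0` for `a = 0`. -/
noncomputable def localOrdInt (p : MaximalSpectrum R) :
    R →*₀ WithZero (Multiplicative ℤ) :=
  (Ring.ordMonoidWithZeroHom (Localization.AtPrime p.asIdeal)).comp
    (algebraMap R (Localization.AtPrime p.asIdeal)).toMonoidWithZeroHom

theorem localOrdInt_eq (p : MaximalSpectrum R) {a : R} (ha : a ≠ 0) :
    localOrdInt p a = WithZero.exp
      ((Module.length (Localization.AtPrime p.asIdeal) (Localization.AtPrime p.asIdeal ⧸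
        Ideal.span {algebraMap R (Localization.AtPrime p.asIdeal) a})).toNat : ℤ) := by
  have := krullDimLE_localization p
  have ha' : algebraMap R (Localization.AtPrime p.asIdeal) a ∈
      nonZeroDivisors (Localization.AtPrime p.asIdeal) := by
    rw [mem_nonZeroDivisors_iff_ne_zero]
    simpa using ha
  exact Ring.ordMonoidWithZeroHom_eq_coe _ ha' (ENat.natCast_toNat (Ring.ord_ne_top ha')).symm

theorem localOrdInt_isUnit (p : MaximalSpectrum R) (a : R⁰) : IsUnit (localOrdInt p a) := by
  rw [localOrdInt_eq p (nonZeroDivisors.ne_zero a.2)]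
  exact isUnit_iff_ne_zero.mpr WithZero.exp_ne_zero

/-- The order `ord_p : Kˣ → ℤ`, `a / b ↦ len (R_p / a R_p) - len (R_p / b R_p)`, as a homomorphism;
see `ord_eq_sub`. -/
noncomputable def ord (p : MaximalSpectrum R) : Additive Kˣ →+ ℤ where
  toFun x := WithZero.log ((IsLocalization.toLocalizationMap R⁰ K).lift₀ (localOrdInt p)
    (localOrdInt_isUnit p) (x.toMul : K))
  map_zero' := by simp
  map_add' x y := by
    rw [toMul_add, Units.val_mul, map_mul, WithZero.log_mul]
    · exact (map_ne_zero _).mpr x.toMul.ne_zero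
    · exact (map_ne_zero _).mpr y.toMul.ne_zero

theorem ord_of_eq_algebraMap (p : MaximalSpectrum R) (x : Kˣ) {a : R} (ha : a ≠ 0)
    (hx : (x : K) = algebraMap R K a) :
    ord K p (Additive.ofMul x) =
      ((Module.length (Localization.AtPrime p.asIdeal) (Localization.AtPrime p.asIdeal ⧸
        Ideal.span {algebraMap R (Localization.AtPrime p.asIdeal) a})).toNat : ℤ) := by
  change WithZero.log ((IsLocalization.toLocalizationMap R⁰ K).lift₀ (localOrdInt p)
    (localOrdInt_isUnit p) (x : K)) = _
  rw [hx]
  have : (IsLocalization.toLocalizationMap R⁰ K).lift₀ (localOrdInt p)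
    (localOrdInt_isUnit p) (algebraMap R K a) = localOrdInt p a :=
    Submonoid.LocalizationMap.lift_eq ..
  rw [this, localOrdInt_eq p ha, WithZero.log_exp]

theorem ord_eq_sub (p : MaximalSpectrum R) (x : Kˣ) {a b : R} (ha : a ≠ 0) (hb : b ≠ 0)
    (hx : (x : K) = algebraMap R K a / algebraMap R K b) :
    ord K p (Additive.ofMul x) =
      ((Module.length (Localization.AtPrime p.asIdeal) (Localization.AtPrime p.asIdeal ⧸
        Ideal.span {algebraMap R (Localization.AtPrime p.asIdeal) a})).toNat : ℤ) -
      ((Module.length (Localization.AtPrime p.asIdeal) (Localization.AtPrime p.asIdeal ⧸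
        Ideal.span {algebraMap R (Localization.AtPrime p.asIdeal) b})).toNat : ℤ) := by
  have ha' : algebraMap R K a ≠ 0 := by simpa using ha
  have hb' : algebraMap R K b ≠ 0 := by simpa using hb
  have hxx : x = Units.mk0 _ ha' / Units.mk0 _ hb' := by
    ext; simp [hx]
  rw [hxx, ofMul_div, map_sub, ord_of_eq_algebraMap K p (Units.mk0 _ ha') ha rfl,
    ord_of_eq_algebraMap K p (Units.mk0 _ hb') hb rfl]

theorem finite_maximal_mem {a : R} (ha : a ≠ 0) :
    {p : MaximalSpectrum R | a ∈ p.asIdeal}.Finite := by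
  have h : {I : Ideal R | I ∈ (Ideal.span {a}).minimalPrimes}.Finite :=
    Ideal.finite_minimalPrimes_of_isNoetherianRing R _
  refine Set.Finite.of_finite_image (f := MaximalSpectrum.asIdeal) (h.subset ?_)
    (fun p _ q _ hpq => MaximalSpectrum.ext hpq)
  rintro _ ⟨p, hp, rfl⟩
  refine ⟨⟨p.isMaximal.isPrime, by simpa [Ideal.span_le] using hp⟩, ?_⟩
  rintro q ⟨hq, hqa⟩ hqp
  have hq0 : q ≠ ⊥ := by
    rintro rfl
    exact ha (by simpa using hqa)
  exact ((hq.isMaximal_of_ne_bot hq0).eq_of_le p.isMaximal.ne_top hqp).ge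

theorem ord_finite (x : Additive Kˣ) : {p : MaximalSpectrum R | ord K p x ≠ 0}.Finite := by
  obtain ⟨a, b, hb, hx⟩ := IsFractionRing.div_surjective (A := R) (x.toMul : K)
  have hb0 := nonZeroDivisors.ne_zero hb
  have ha0 : a ≠ 0 := by
    rintro rfl
    rw [map_zero, zero_div] at hx
    exact x.toMul.ne_zero hx.symm
  refine ((finite_maximal_mem ha0).union (finite_maximal_mem hb0)).subset ?_
  intro p hp
  by_contra hcon
  simp only [Set.mem_union, Set.mem_ofPred_eq, not_or] at hcon
  apply hp
  have hu : ∀ c : R, c ∉ p.asIdeal →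
      Module.length (Localization.AtPrime p.asIdeal) (Localization.AtPrime p.asIdeal ⧸
        Ideal.span {algebraMap R (Localization.AtPrime p.asIdeal) c}) = 0 := fun c hc =>
    Ring.ord_of_isUnit (IsLocalization.map_units (M := p.asIdeal.primeCompl) _ ⟨c, hc⟩)
  have := ord_eq_sub K p x.toMul ha0 hb0 hx.symm
  rw [hu a hcon.1, hu b hcon.2] at this
  simpa using this

variable (R)

/-- The homomorphism `Kˣ → Div R`, `a ↦ ∑ ord_p(a) p`. -/
noncomputable def principalDivisor : Additive Kˣ →+ Divisors R where
  toFun x := Finsupp.ofSupportFinite (fun p => ord K p x) (ord_finite K x)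
  map_zero' := Finsupp.ext fun p => map_zero (ord K p)
  map_add' x y := Finsupp.ext fun p => map_add (ord K p) x y

/-- The Chow group: divisors modulo principal divisors. -/
abbrev Chow : Type _ := Divisors R ⧸ (principalDivisor R K).range

end Divisors

section Pushforward

variable (R : Type*) {S : Type*} [CommRing R] [CommRing S] [Algebra R S]

/-- The map on maximal spectra `P ↦ P ∩ R` of an integral extension. -/
def contract [Algebra.IsIntegral R S] (P : MaximalSpectrum S) : MaximalSpectrum R :=
  ⟨P.asIdeal.under R, Ideal.isMaximal_comap_of_isIntegral_of_isMaximal P.asIdeal⟩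

/-- The residue degree of a maximal ideal `P` of `S`: the degree of `S / P` over `R / (P ∩ R)`. -/
noncomputable def resDeg (P : MaximalSpectrum S) : ℕ :=
  Module.finrank (R ⧸ P.asIdeal.under R) (S ⧸ P.asIdeal)

/-- The push-forward of divisors, `P ↦ deg(P) (P ∩ R)`. -/
noncomputable def pushforward [Algebra.IsIntegral R S] : Divisors S →+ Divisors R :=
  (Finsupp.linearCombination ℤ fun P : MaximalSpectrum S =>
    Finsupp.single (contract R P) (resDeg R P : ℤ)).toAddMonoidHom

variable {R} in
/-- The maximal ideals of `S` over a maximal ideal `p` of `R`. -/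
abbrev Above [Algebra.IsIntegral R S] (p : MaximalSpectrum R) : Type _ :=
  {P : MaximalSpectrum S // contract R P = p}

instance [Algebra.IsIntegral R S] [Module.Finite R S] (p : MaximalSpectrum R) :
    Finite (Above (S := S) p) := by
  have : Finite (p.asIdeal.primesOver S) := Algebra.QuasiFinite.finite_primesOver p.asIdeal
  refine Finite.of_injective (β := p.asIdeal.primesOver S)
    (fun P => ⟨P.1.asIdeal, P.1.isMaximal.isPrime, ⟨(congrArg MaximalSpectrum.asIdeal P.2).symm⟩⟩) ?_
  intro P Q h
  exact Subtype.ext (MaximalSpectrum.ext (congrArg Subtype.val h))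

noncomputable instance [Algebra.IsIntegral R S] [Module.Finite R S] (p : MaximalSpectrum R) :
    Fintype (Above (S := S) p) := Fintype.ofFinite _

variable {R} in
/-- The greatest common divisor of the residue degrees of the maximal ideals of `S` over `p`. -/
noncomputable def gcdDeg (S : Type*) [CommRing S] [Algebra R S] [Algebra.IsIntegral R S]
    [Module.Finite R S] (p : MaximalSpectrum R) : ℕ :=
  Finset.univ.gcd fun P : Above (S := S) p => resDeg R P.1

end Pushforward

section DedekindDivisors

variable {S : Type*} [CommRing S] [IsDedekindDomain S] [IsOneDimensional S]
variable (K : Type*) [Field K] [Algebra S K] [IsFractionRing S K]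

/-- The divisor `∑ v_P(A) P` of a nonzero fractional ideal `A = ∏ P ^ v_P(A)` of a Dedekind
domain. -/
noncomputable def idealDivisor (A : (FractionalIdeal S⁰ K)ˣ) : Divisors S :=
  Finsupp.ofSupportFinite
    (fun P => FractionalIdeal.count K (toHeightOne S P) (A : FractionalIdeal S⁰ K)) <| by
      have h := FractionalIdeal.finite_factors (A : FractionalIdeal S⁰ K)
      rw [Filter.eventually_cofinite] at h
      refine Set.Finite.preimage (f := toHeightOne S) ?_ h
      intro P _ Q _ hPQ
      exact MaximalSpectrum.ext (congrArg IsDedekindDomain.HeightOneSpectrum.asIdeal hPQ)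

/-- A maximal ideal of a one-dimensional Dedekind domain as an invertible fractional ideal. -/
noncomputable def idealUnit (P : MaximalSpectrum S) : (FractionalIdeal S⁰ K)ˣ :=
  Units.mk0 (P.asIdeal : FractionalIdeal S⁰ K)
    (FractionalIdeal.coeIdeal_ne_zero.mpr (maximal_ne_bot P))

end DedekindDivisors

section Normalization

variable (O : Type*) [CommRing O] [IsDomain O] [IsNoetherianRing O] [IsOneDimensional O]
variable (K : Type*) [Field K] [Algebra O K] [IsFractionRing O K]

instance : IsFractionRing (integralClosure O K) K :=
  have : Algebra.IsAlgebraic O K :=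
    IsFractionRing.comap_isAlgebraic_iff.mpr (inferInstance : Algebra.IsAlgebraic K K)
  integralClosure.isFractionRing_of_algebraic (A := O) (L := K) fun x hx => by
    simpa using hx

instance : Ring.DimensionLEOne (integralClosure O K) :=
  have : Ring.DimensionLEOne O := ⟨fun hp0 hp => hp.isMaximal_of_ne_bot hp0⟩
  inferInstance

instance : IsOneDimensional (integralClosure O K) where
  ringKrullDim_eq_one := by
    have hle : ringKrullDim (integralClosure O K) ≤ 1 :=
      Order.KrullDimLE.krullDim_le (n := 1)
    refine le_antisymm hle ?_
    by_contra hlt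
    have h0 : Ring.KrullDimLE 0 (integralClosure O K) := by
      rw [Ring.KrullDimLE, Order.krullDimLE_iff]
      exact ENat.WithBot.lt_add_one_iff.mp (not_le.mp hlt)
    exact not_isField O (isField_of_isIntegral_of_isField
      (FaithfulSMul.algebraMap_injective O (integralClosure O K)) Ring.KrullDimLE.isField_of_isDomain)

instance [Module.Finite O (integralClosure O K)] : IsDedekindDomain (integralClosure O K) where
  toIsDedekindRing := by
    refine (isDedekindRing_iff _ K).mpr
      ⟨IsNoetherianRing.of_finite O _, inferInstance, fun {x} hx => ?_⟩
    exact ⟨⟨x, isIntegral_trans x hx⟩, rfl⟩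

/-- The maximal ideals of `O` that are not invertible (as fractional ideals). -/
abbrev NonInvertible : Type _ :=
  {p : MaximalSpectrum O // ¬ IsUnit (p.asIdeal : FractionalIdeal O⁰ K)}

variable [Module.Finite O (integralClosure O K)]

/-- A choice of integers `lam p P`, for `p` a non-invertible maximal ideal of `O` and `P` a
maximal ideal of the normalization over `p`. -/
abbrev Coefficients : Type _ :=
  ∀ p : NonInvertible O K, Above (S := integralClosure O K) p.1 → ℤ

variable {O K}

/-- The fractional ideal `Q_p = ∏ P ^ lam p P`, the product over the maximal ideals `P` of the
normalization over `p`. -/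
noncomputable def idealQ (lam : Coefficients O K) (p : NonInvertible O K) :
    (FractionalIdeal (integralClosure O K)⁰ K)ˣ :=
  ∏ P : Above (S := integralClosure O K) p.1, idealUnit K P.1 ^ lam p P

/-- The subgroup `N` of the class group of the normalization, generated by the classes of
`Q_p ^ (d_P / g_p) * P⁻¹` for `p` non-invertible and `P` over `p`. -/
noncomputable def subgroupN (lam : Coefficients O K) : Subgroup (ClassGroup (integralClosure O K)) :=
  Subgroup.closure {c | ∃ (p : NonInvertible O K) (P : Above (S := integralClosure O K) p.1),
    c = ClassGroup.mk K (idealQ lam p ^ (resDeg O P.1 / gcdDeg (integralClosure O K) p.1) *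
      (idealUnit K P.1)⁻¹)}

/-- The group `G = ⨁ ℤ p ⊕ Cl / N`, the sum over the non-invertible maximal ideals `p`. -/
abbrev groupG (lam : Coefficients O K) : Type _ :=
  (NonInvertible O K →₀ ℤ) × Additive (ClassGroup (integralClosure O K) ⧸ subgroupN lam)

/-- The element `(a, [A])` of `G`. -/
noncomputable def elemG (lam : Coefficients O K) (a : NonInvertible O K →₀ ℤ)
    (A : (FractionalIdeal (integralClosure O K)⁰ K)ˣ) : groupG lam :=
  (a, Additive.ofMul (QuotientGroup.mk (ClassGroup.mk K A)))

/-- The subgroup `R` of `G` generated by the elements `(g_p p, [Q_p⁻¹])`. -/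
noncomputable def subgroupR (lam : Coefficients O K) : AddSubgroup (groupG lam) :=
  AddSubgroup.closure (Set.range fun p : NonInvertible O K =>
    elemG lam (Finsupp.single p (gcdDeg (integralClosure O K) p.1 : ℤ)) (idealQ lam p)⁻¹)

end Normalization

end OneDimDomain

/-! The bridge between the two rings is local length. For nonzero `a` in `O`, the lengths of `O/a`
and `Õ/a` at `p` agree, because `Õ/O` has finite length at `p` and cancels
(`localLength_quotient_span_algebraMap`). The length of `Õ/I` is additive along the prime
factorization of `I`, each prime `P` over `p` contributing its residue degree
(`localLength_quotient_ideal`). Hence `f_* (div (x))` is the principal divisor of `x` on `O`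
(`pushforward_toPrincipalIdeal`), and `f_* ∘ div` descends from ideals to `Cl(Õ) → Chow(O)`.

If `p` is invertible, then `p O_p` has a generator `x` and `1 = len (O_p / x) = ∑ v_P(x) d_P`. So
exactly one `P` lies over `p`, of degree 1, and `p = f_* P` (`existsUnique_contract_of_isUnit`).
Invertible ideals are therefore reached through `Cl(Õ)`, the others through the free summand. A
maximal ideal avoiding a nonzero `c` with `c Õ ⊆ O` is invertible, so only finitely many are not.

For the kernel one works with pairs `(a, A)` before passing to classes. If `a + f_* (div A) = 0`,
then `A` involves only primes `P` over non-invertible `p`, so `(a, A)` is a combination of the pairs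
`(-d_P p, P)`. Modulo `N` the class of `P` is that of `Q_p ^ (d_P / g_p)`, so such a pair becomes
`-(d_P / g_p)` times a generator of `R`. A principal divisor in place of `0` is absorbed by dividing
`A` by a principal ideal. -/

namespace OneDimDomain

/-! ### Length of a module localized at a prime -/

section LocalLength

variable {R : Type*} [CommRing R] (p : Ideal R) [p.IsPrime]

/-- The length of the localization of an `R`-module at a prime ideal `p`. -/
noncomputable def localLength (M : Type*) [AddCommGroup M] [Module R M] : ℕ∞ :=
  Module.length (Localization.AtPrime p) (LocalizedModule p.primeCompl M)

variable {M N P : Type*} [AddCommGroup M] [Module R M] [AddCommGroup N] [Module R N]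
  [AddCommGroup P] [Module R P]

theorem localLength_eq_length [Module (Localization.AtPrime p) N]
    [IsScalarTower R (Localization.AtPrime p) N] (f : M →ₗ[R] N)
    [IsLocalizedModule p.primeCompl f] :
    localLength p M = Module.length (Localization.AtPrime p) N := by
  have e := IsLocalizedModule.linearEquiv p.primeCompl
    (LocalizedModule.mkLinearMap p.primeCompl M) f
  exact LinearEquiv.length_eq (e.extendScalarsOfIsLocalization p.primeCompl _)

theorem localLength_eq_add_of_exact {f : M →ₗ[R] N} {g : N →ₗ[R] P}
    (hf : Function.Injective f) (hg : Function.Surjective g) (h : Function.Exact f g) :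
    localLength p N = localLength p M + localLength p P := by
  exact Module.length_eq_add_of_exact
    ((IsLocalizedModule.map p.primeCompl
      (LocalizedModule.mkLinearMap p.primeCompl M)
      (LocalizedModule.mkLinearMap p.primeCompl N) f).extendScalarsOfIsLocalization
        p.primeCompl (Localization.AtPrime p))
    ((IsLocalizedModule.map p.primeCompl
      (LocalizedModule.mkLinearMap p.primeCompl N)
      (LocalizedModule.mkLinearMap p.primeCompl P) g).extendScalarsOfIsLocalization
        p.primeCompl (Localization.AtPrime p))
    (IsLocalizedModule.map_injective p.primeCompl _ _ f hf)
    (IsLocalizedModule.map_surjective p.primeCompl _ _ g hg)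
    (IsLocalizedModule.map_exact p.primeCompl _ _ _ f g h)

theorem localLength_eq_zero_of_subsingleton [Subsingleton M] : localLength p M = 0 :=
  Module.length_eq_zero_iff.mpr <| LocalizedModule.subsingleton_iff.mpr
    fun _ => ⟨1, one_mem _, Subsingleton.elim _ _⟩

theorem localLength_eq_zero {s : R} (hs : s ∉ p) (h : ∀ m : M, s • m = 0) :
    localLength p M = 0 :=
  Module.length_eq_zero_iff.mpr <| LocalizedModule.subsingleton_iff.mpr
    fun m => ⟨s, hs, h m⟩

theorem localLength_congr (e : M ≃ₗ[R] N) : localLength p M = localLength p N := by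
  have h := localLength_eq_add_of_exact p (f := (0 : PUnit →ₗ[R] M)) (g := e.toLinearMap)
    (Function.injective_of_subsingleton _) e.surjective
    ((LinearMap.exact_zero_iff_injective _ _).mpr e.injective)
  rwa [localLength_eq_zero_of_subsingleton p (M := PUnit), zero_add] at h

theorem localLength_le_of_surjective {g : M →ₗ[R] N} (hg : Function.Surjective g) :
    localLength p N ≤ localLength p M := by
  rw [localLength_eq_add_of_exact p (LinearMap.ker g).subtype_injective hg
    (LinearMap.exact_subtype_ker_map g)]
  exact le_add_self

/-- The cokernels form a short exact sequence `0 → coker f → coker (g ∘ f) → coker g → 0`;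
injectivity of `g` gives exactness on the left. -/
theorem localLength_cokernel_comp (f : M →ₗ[R] N) {g : N →ₗ[R] P} (hg : Function.Injective g) :
    localLength p (P ⧸ LinearMap.range (g ∘ₗ f)) =
      localLength p (N ⧸ LinearMap.range f) + localLength p (P ⧸ LinearMap.range g) := by
  have aux : LinearMap.range f = (LinearMap.range (g ∘ₗ f)).comap g := by
    rw [LinearMap.range_comp, Submodule.comap_map_eq_of_injective hg]
  refine localLength_eq_add_of_exact p
    (f := (LinearMap.range f).mapQ (LinearMap.range (g ∘ₗ f)) g aux.le)
    (g := Submodule.factor (LinearMap.range_comp_le_range f g)) ?_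
    (Submodule.factor_surjective _) ?_
  · rw [← LinearMap.ker_eq_bot, Submodule.ker_mapQ, ← aux]
    simp
  · rw [LinearMap.exact_iff]
    simp [Submodule.factor, Submodule.ker_mapQ, Submodule.range_mapQ]

theorem localLength_quotient (I : Ideal R) :
    localLength p (R ⧸ I) = Module.length (Localization.AtPrime p)
      (Localization.AtPrime p ⧸ I.map (algebraMap R (Localization.AtPrime p))) := by
  have h := localLength_eq_length p (Submodule.toLocalizedQuotient' (Localization.AtPrime p)
    p.primeCompl (Algebra.linearMap R (Localization.AtPrime p)) I)
  rw [Submodule.localized'_eq_span] at h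
  exact h

theorem localLength_quotient_self : localLength p (R ⧸ p) = 1 := by
  rw [localLength_quotient, Module.length_eq_one_iff, isSimpleModule_iff_quot_maximal]
  rw [Localization.AtPrime.map_eq_maximalIdeal]
  exact ⟨_, IsLocalRing.maximalIdeal.isMaximal _, ⟨LinearEquiv.refl _ _⟩⟩

theorem localLength_fin_fun (n : ℕ) : localLength p (Fin n → M) = n * localLength p M := by
  rw [localLength_eq_length p (.pi fun i : Fin n =>
    LocalizedModule.mkLinearMap p.primeCompl M ∘ₗ LinearMap.proj i), Module.length_pi]
  simp [localLength]

theorem localLength_eq_finrank [p.IsMaximal] [Module (R ⧸ p) M] [IsScalarTower R (R ⧸ p) M]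
    [Module.Finite (R ⧸ p) M] : localLength p M = Module.finrank (R ⧸ p) M := by
  let := Ideal.Quotient.field p
  have e := (Module.finBasis (R ⧸ p) M).equivFun.restrictScalars R
  rw [localLength_congr p e, localLength_fin_fun, localLength_quotient_self, mul_one]

end LocalLength

/-! ### Divisors of fractional ideals of a Dedekind domain -/

section IdealDivisor

variable {S : Type*} [CommRing S] [IsDedekindDomain S] [IsOneDimensional S]
variable (K : Type*) [Field K] [Algebra S K] [IsFractionRing S K]

theorem idealDivisor_apply (A : (FractionalIdeal S⁰ K)ˣ) (P : MaximalSpectrum S) :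
    idealDivisor K A P = FractionalIdeal.count K (toHeightOne S P) (A : FractionalIdeal S⁰ K) :=
  rfl

/-- `idealDivisor` as a homomorphism. -/
noncomputable def idealDivisorHom : Additive (FractionalIdeal S⁰ K)ˣ →+ Divisors S where
  toFun A := idealDivisor K A.toMul
  map_zero' := Finsupp.ext fun _ => FractionalIdeal.count_one K _
  map_add' A B := Finsupp.ext fun _ =>
    FractionalIdeal.count_mul K _ A.toMul.ne_zero B.toMul.ne_zero

theorem idealDivisor_eq_hom (A : (FractionalIdeal S⁰ K)ˣ) :
    idealDivisor K A = idealDivisorHom K (Additive.ofMul A) := rfl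

theorem idealDivisor_idealUnit (P : MaximalSpectrum S) :
    idealDivisor K (idealUnit K P) = Finsupp.single P 1 := by
  classical
  ext Q
  rw [idealDivisor_apply, Finsupp.single_apply]
  have hPQ : toHeightOne S P = toHeightOne S Q ↔ P = Q :=
    ⟨fun h => MaximalSpectrum.ext (congrArg IsDedekindDomain.HeightOneSpectrum.asIdeal h),
      fun h => h ▸ rfl⟩
  have h := FractionalIdeal.count_maximal K (toHeightOne S Q) (toHeightOne S P)
  simp only [hPQ] at h
  exact h

theorem idealDivisor_injective : Function.Injective (idealDivisorHom (S := S) K) := by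
  rw [injective_iff_map_eq_zero]
  intro A hA
  have h := FractionalIdeal.finprod_heightOneSpectrum_factorization' K A.toMul.ne_zero
  refine Additive.toMul.injective (Units.ext ?_)
  rw [← h]
  refine finprod_eq_one_of_forall_eq_one fun v => ?_
  have h2 := DFunLike.congr_fun hA ⟨v.asIdeal, v.isPrime.isMaximal v.ne_bot⟩
  have h3 : FractionalIdeal.count K v (A.toMul : FractionalIdeal S⁰ K) = 0 := h2
  rw [h3, zpow_zero]

end IdealDivisor

/-! ### Push-forward of divisors and residue degrees -/

section Pushforward

variable (R : Type*) {S : Type*} [CommRing R] [CommRing S] [Algebra R S] [Algebra.IsIntegral R S]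

theorem pushforward_single (P : MaximalSpectrum S) (n : ℤ) :
    pushforward R (Finsupp.single P n) = Finsupp.single (contract R P) (n * resDeg R P) := by
  simp [pushforward]

theorem pushforward_apply [Module.Finite R S] (D : Divisors S) (p : MaximalSpectrum R) :
    pushforward R D p = ∑ P : Above (S := S) p, D P.1 * resDeg R P.1 := by
  classical
  induction D using Finsupp.induction_linear with
  | zero => simp
  | add D E hD hE => simp [hD, hE, add_mul, Finset.sum_add_distrib]
  | single Q n =>
    rw [pushforward_single, Finsupp.single_apply]
    split_ifs with h
    · rw [Fintype.sum_eq_single ⟨Q, h⟩]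
      · simp
      · intro P hP
        rw [Finsupp.single_eq_of_ne, zero_mul]
        rintro h2
        exact hP (Subtype.ext h2)
    · refine (Finset.sum_eq_zero fun P _ => ?_).symm
      rw [Finsupp.single_eq_of_ne, zero_mul]
      rintro h2
      exact h (h2 ▸ P.2)

theorem gcdDeg_mul_div [Module.Finite R S] (p : MaximalSpectrum R) (P : Above (S := S) p) :
    resDeg R P.1 / gcdDeg S p * gcdDeg S p = resDeg R P.1 :=
  Nat.div_mul_cancel (Finset.gcd_dvd (f := fun P : Above (S := S) p => resDeg R P.1)
    (Finset.mem_univ P))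

theorem resDeg_pos [Module.Finite R S] (P : MaximalSpectrum S) : 0 < resDeg R P := by
  have : (P.asIdeal.under R).IsMaximal := (contract R P).isMaximal
  let := Ideal.Quotient.field (P.asIdeal.under R)
  have : Module.Finite (R ⧸ P.asIdeal.under R) (S ⧸ P.asIdeal) :=
    Module.Finite.of_restrictScalars_finite R _ _
  have : Nontrivial (S ⧸ P.asIdeal) := Ideal.Quotient.nontrivial_iff.mpr P.isMaximal.ne_top
  exact Module.finrank_pos (R := R ⧸ P.asIdeal.under R)

/-- Over `p` the quotient is a vector space over `R / p`, whose length is its dimension. Otherwise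
some element of `Q ∩ R` outside `p` kills it. The witness `n` records finiteness of the length
together with its value as an integer. -/
theorem localLength_quotient_maximal [Module.Finite R S] (p : MaximalSpectrum R)
    (Q : MaximalSpectrum S) : ∃ n : ℕ, localLength p.asIdeal (S ⧸ Q.asIdeal) = n ∧
      (n : ℤ) = pushforward R (Finsupp.single Q 1) p := by
  classical
  rw [pushforward_single, one_mul]
  by_cases h : contract R Q = p
  · subst h
    refine ⟨resDeg R Q, ?_, by simp⟩
    have : (Q.asIdeal.under R).IsMaximal := (contract R Q).isMaximal
    have : Module.Finite (R ⧸ Q.asIdeal.under R) (S ⧸ Q.asIdeal) :=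
      Module.Finite.of_restrictScalars_finite R _ _
    exact localLength_eq_finrank (Q.asIdeal.under R)
  · refine ⟨0, ?_, by simp [h]⟩
    have hle : ¬ (contract R Q).asIdeal ≤ p.asIdeal := fun hle => h <| MaximalSpectrum.ext <|
      (contract R Q).isMaximal.eq_of_le p.isMaximal.ne_top hle
    obtain ⟨s, hs, hsp⟩ := SetLike.not_le_iff_exists.mp hle
    refine localLength_eq_zero _ hsp fun m => ?_
    obtain ⟨x, rfl⟩ := Submodule.Quotient.mk_surjective _ m
    rw [← Submodule.Quotient.mk_smul, Submodule.Quotient.mk_eq_zero, Algebra.smul_def]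
    exact Ideal.mul_mem_right _ _ hs

end Pushforward

/-! ### Length of a quotient of a Dedekind extension -/

section Length

variable {R : Type*} {S : Type*} [CommRing R] [CommRing S] [Algebra R S] [IsDedekindDomain S]

/-- Any `b` in `J` outside `Q * J` works, since no ideal lies strictly between `Q * J` and `J`.
Multiplication by `b` then identifies `S / Q` with `J / Q J`. -/
theorem _root_.Ideal.exists_comap_mulLeft_eq {Q J : Ideal S} (hQ : Q.IsMaximal) (hJ : J ≠ 0) :
    ∃ b : S, Submodule.comap (LinearMap.mulLeft S b) (Q * J) = Q ∧
      Ideal.span {b} ⊔ Q * J = J := by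
  have hne : ¬ J ≤ Q * J := by
    rw [← Ideal.dvd_iff_le]
    intro h
    have h1 := mul_dvd_mul_iff_right hJ (a := Q) (b := 1)
    rw [one_mul] at h1
    have h2 := isUnit_iff_eq_one.mp (isUnit_of_dvd_one (h1.mp h))
    rw [Ideal.one_eq_top] at h2
    exact hQ.ne_top h2
  obtain ⟨b, hbJ, hb⟩ := SetLike.not_le_iff_exists.mp hne
  have hQb : Q ≤ Submodule.comap (LinearMap.mulLeft S b) (Q * J) := fun s hs => by
    change b * s ∈ Q * J
    exact mul_comm b s ▸ Ideal.mul_mem_mul hs hbJ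
  refine ⟨b, (hQ.eq_of_le ?_ hQb).symm, ?_⟩
  · rw [Ne, Ideal.eq_top_iff_one]
    intro h
    exact hb (by simpa using h)
  have hle : Ideal.span {b} ⊔ Q * J ≤ J :=
    sup_le (by simpa [Ideal.span_le] using hbJ) Ideal.mul_le_right
  obtain ⟨X, hX⟩ := Ideal.dvd_iff_le.mpr hle
  have hQX : Q ≤ X := by
    rw [← Ideal.dvd_iff_le]
    have : J * X ∣ J * Q := by
      rw [← hX, mul_comm J, Ideal.dvd_iff_le]
      exact le_sup_right
    exact (mul_dvd_mul_iff_left hJ).mp this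
  have hXQ : X ≠ Q := by
    rintro rfl
    refine hb ?_
    rw [mul_comm, ← hX]
    exact Ideal.mem_sup_left (Ideal.mem_span_singleton_self b)
  have hX1 : X = ⊤ := by
    by_contra hXt
    exact hXQ (hQ.eq_of_le hXt hQX).symm
  rw [hX, hX1, Ideal.mul_top]

/-- Length is additive on `0 → S/Q → S/QJ → S/J → 0`, where the first map is multiplication by the
`b` of the previous lemma. -/
theorem localLength_quotient_mul (p : Ideal R) [p.IsPrime] {Q J : Ideal S} (hQ : Q.IsMaximal)
    (hJ : J ≠ 0) :
    localLength p (S ⧸ Q * J) = localLength p (S ⧸ Q) + localLength p (S ⧸ J) := by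
  obtain ⟨b, hker, hJb⟩ := Ideal.exists_comap_mulLeft_eq hQ hJ
  let f : (S ⧸ Q) →ₗ[S] (S ⧸ Q * J) :=
    Submodule.mapQ Q (Q * J) (LinearMap.mulLeft S b) hker.ge
  let g : (S ⧸ Q * J) →ₗ[S] (S ⧸ J) := Submodule.factor Ideal.mul_le_right
  have hf : Function.Injective f := by
    rw [← LinearMap.ker_eq_bot, Submodule.ker_mapQ, hker]
    simp
  have hfg : Function.Exact f g := by
    have hr : LinearMap.range (LinearMap.mulLeft S b) = Ideal.span {b} := by
      ext x
      simp [Ideal.mem_span_singleton', mul_comm]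
    have h0 : Submodule.map (Q * J).mkQ (Q * J) = ⊥ := by simp
    rw [LinearMap.exact_iff, Submodule.ker_mapQ, Submodule.range_mapQ, Submodule.comap_id, hr]
    have h := congrArg (Submodule.map (Q * J).mkQ) hJb
    rw [Submodule.map_sup, h0, sup_bot_eq] at h
    exact h.symm
  have hg : Function.Surjective g := Submodule.factor_surjective _
  clear_value f g
  have hf' : Function.Injective (f.restrictScalars R) := hf
  have hg' : Function.Surjective (g.restrictScalars R) := hg
  have hfg' : Function.Exact (f.restrictScalars R) (g.restrictScalars R) := hfg
  exact localLength_eq_add_of_exact p hf' hg' hfg'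

variable [IsOneDimensional S] [Algebra.IsIntegral R S] [Module.Finite R S]
variable (K : Type*) [Field K] [Algebra S K] [IsFractionRing S K]

/-- Both sides are additive when a prime factor is split off, so the case of a maximal ideal
suffices. -/
theorem localLength_quotient_ideal (p : MaximalSpectrum R) (I : Ideal S)
    (A : (FractionalIdeal S⁰ K)ˣ) (hA : (A : FractionalIdeal S⁰ K) = I) :
    ∃ n : ℕ, localLength p.asIdeal (S ⧸ I) = n ∧
      (n : ℤ) = pushforward R (idealDivisor K A) p := by
  revert A
  induction I using UniqueFactorizationMonoid.induction_on_prime with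
  | h₁ =>
    intro A hA
    exact absurd (hA.trans (by simp)) A.ne_zero
  | h₂ I hI =>
    intro A hA
    obtain rfl := isUnit_iff_eq_one.mp hI
    obtain rfl : A = 1 := Units.ext (by simpa using hA)
    refine ⟨0, ?_, ?_⟩
    · have : Subsingleton (S ⧸ (1 : Ideal S)) := by
        rw [Ideal.one_eq_top]
        infer_instance
      exact localLength_eq_zero_of_subsingleton _
    · rw [idealDivisor_eq_hom, ofMul_one, map_zero, map_zero]
      rfl
  | h₃ J Q hJ hQ ih =>
    intro A hA
    have hQm : Q.IsMaximal := (Ideal.isPrime_of_prime hQ).isMaximal hQ.ne_zero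
    have hJ' : (J : FractionalIdeal S⁰ K) ≠ 0 := FractionalIdeal.coeIdeal_ne_zero.mpr hJ
    obtain ⟨n, hn, hn'⟩ := ih (Units.mk0 _ hJ') rfl
    obtain ⟨m, hm, hm'⟩ := localLength_quotient_maximal R p (⟨Q, hQm⟩ : MaximalSpectrum S)
    have hAe : A = idealUnit K ⟨Q, hQm⟩ * Units.mk0 _ hJ' := by
      ext1
      rw [hA, FractionalIdeal.coeIdeal_mul]
      rfl
    refine ⟨m + n, ?_, ?_⟩
    · rw [localLength_quotient_mul _ hQm hJ, hn, hm, Nat.cast_add]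
    · rw [hAe, idealDivisor_eq_hom, ofMul_mul, map_add, map_add, Nat.cast_add, hn', hm',
        ← idealDivisor_eq_hom, ← idealDivisor_eq_hom, idealDivisor_idealUnit]
      rfl

end Length

/-! ### Comparing lengths over a ring and an extension of finite colength -/

section FiniteIndex

variable {R S : Type*} [CommRing R] [CommRing S] [IsDomain S] [Algebra R S]

/-- The map `R → S`, `x ↦ a x`, factors through multiplication by `a` on `R` and also through
multiplication by `a` on `S`. Computing the length of its cokernel both ways gives `len (R/a) + len
(S/R) = len (S/R) + len (S/a)`. -/
theorem localLength_quotient_span_algebraMap [FaithfulSMul R S] (p : Ideal R) [p.IsPrime] {a c : R}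
    (ha : a ≠ 0) (hc : ∀ s : S, ∃ r : R, algebraMap R S r = c • s)
    (hfin : localLength p (S ⧸ Ideal.span {algebraMap R S c}) ≠ ⊤) :
    localLength p (R ⧸ Ideal.span {a}) =
      localLength p (S ⧸ Ideal.span {algebraMap R S a}) := by
  have hinj := FaithfulSMul.algebraMap_injective R S
  have ha' : algebraMap R S a ≠ 0 := by
    rwa [Ne, map_eq_zero_iff _ hinj]
  let i : R →ₗ[R] S := Algebra.linearMap R S
  let m : R →ₗ[R] R := LinearMap.mulLeft R a
  let m' : S →ₗ[R] S := LinearMap.mulLeft R (algebraMap R S a)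
  have hcomm : i ∘ₗ m = m' ∘ₗ i := LinearMap.ext fun x => by simp [i, m, m']
  have hr : LinearMap.range m = Ideal.span {a} := by
    ext x
    simp [m, Ideal.mem_span_singleton', mul_comm]
  have hr' : ∀ b : R, LinearMap.range (LinearMap.mulLeft R (algebraMap R S b)) =
      (Ideal.span {algebraMap R S b}).restrictScalars R := fun b => by
    ext x
    simp [Ideal.mem_span_singleton', mul_comm]
  have e : ∀ b : R, localLength p (S ⧸ LinearMap.range (LinearMap.mulLeft R (algebraMap R S b))) =
      localLength p (S ⧸ Ideal.span {algebraMap R S b}) := fun b =>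
    localLength_congr p ((Submodule.quotEquivOfEq _ _ (hr' b)).trans
      (Submodule.Quotient.restrictScalarsEquiv R _))
  have h1 := localLength_cokernel_comp p m (g := i) hinj
  have h2 := localLength_cokernel_comp p i (g := m') (mul_right_injective₀ ha')
  have hle : LinearMap.range (LinearMap.mulLeft R (algebraMap R S c)) ≤ LinearMap.range i := by
    rintro _ ⟨s, rfl⟩
    obtain ⟨r, hr⟩ := hc s
    exact ⟨r, by simpa [Algebra.smul_def, i] using hr⟩
  -- Cancelling in `ℕ∞` needs `S / R` to have finite length; it is a quotient of `S / c S` because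
  -- `c S ⊆ R`.
  have hfin' : localLength p (S ⧸ LinearMap.range i) ≠ ⊤ :=
    ne_top_of_le_ne_top (by rwa [e c])
      (localLength_le_of_surjective p (Submodule.factor_surjective hle))
  rw [hcomm, h2, add_comm] at h1
  have h3 := WithTop.add_right_cancel hfin' h1
  rw [e a, hr] at h3
  exact h3.symm

end FiniteIndex

/-! ### Principal divisors as push-forwards from the normalization -/

section Normalization

variable (O : Type*) [CommRing O] [IsDomain O]
variable (K : Type*) [Field K] [Algebra O K] [IsFractionRing O K]
variable [Module.Finite O (integralClosure O K)]

/-- A finitely generated submodule of `K` has a common denominator. -/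
theorem exists_conductor : ∃ c : O, c ≠ 0 ∧ ∀ s : integralClosure O K, ∃ r : O,
    algebraMap O (integralClosure O K) r = c • s := by
  have hfg : (Subalgebra.toSubmodule (integralClosure O K)).FG :=
    Module.Finite.iff_fg.mp (inferInstanceAs (Module.Finite O (integralClosure O K)))
  obtain ⟨c, hc, h⟩ := FractionalIdeal.isFractional_of_fg (S := O⁰) hfg
  refine ⟨c, nonZeroDivisors.ne_zero hc, fun s => ?_⟩
  obtain ⟨r, hr⟩ := h s s.2
  exact ⟨r, Subtype.ext hr⟩

variable {O} [IsNoetherianRing O] [IsOneDimensional O]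

theorem pushforward_toPrincipalIdeal (x : Kˣ) :
    pushforward O (idealDivisor K (toPrincipalIdeal (integralClosure O K) K x)) =
      principalDivisor O K (Additive.ofMul x) := by
  let f : Additive Kˣ →+ Divisors O := (pushforward O).comp ((idealDivisorHom K).comp
    (toPrincipalIdeal (integralClosure O K) K).toAdditive)
  -- Both sides are homomorphisms on `Kˣ`, so it is enough to treat nonzero elements of `O`.
  have key : ∀ (x : Kˣ) (a : O), a ≠ 0 → (x : K) = algebraMap O K a →
      f (Additive.ofMul x) = principalDivisor O K (Additive.ofMul x) := by
    intro x a ha hx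
    ext p
    obtain ⟨c, hc0, hc⟩ := exists_conductor O K
    have hinj := FaithfulSMul.algebraMap_injective O (integralClosure O K)
    have hA : ∀ b : O, ∀ y : Kˣ, (y : K) = algebraMap O K b →
        (toPrincipalIdeal (integralClosure O K) K y : FractionalIdeal (integralClosure O K)⁰ K) =
          (Ideal.span {algebraMap O (integralClosure O K) b} : Ideal (integralClosure O K)) := by
      intro b y hy
      rw [coe_toPrincipalIdeal, FractionalIdeal.coeIdeal_span_singleton, hy]
      rfl
    have hc' : algebraMap O K c ≠ 0 := by simpa using hc0
    -- Only the finiteness of the length at `c` matters here.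
    obtain ⟨m, hm, -⟩ := localLength_quotient_ideal K p _ _ (hA c (Units.mk0 _ hc') rfl)
    obtain ⟨n, hn, hn'⟩ := localLength_quotient_ideal K p _ _ (hA a x hx)
    rw [← localLength_quotient_span_algebraMap p.asIdeal ha hc (by rw [hm]; exact ENat.natCast_ne_top m),
      localLength_quotient, Ideal.map_span, Set.image_singleton] at hn
    have h1 : principalDivisor O K (Additive.ofMul x) p = ord K p (Additive.ofMul x) := rfl
    rw [h1, ord_of_eq_algebraMap K p x ha hx, hn]
    exact hn'.symm
  obtain ⟨a, b, hb, hx⟩ := IsFractionRing.div_surjective (A := O) (x : K)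
  have hb' : algebraMap O K b ≠ 0 := by simpa using nonZeroDivisors.ne_zero hb
  have ha' : algebraMap O K a ≠ 0 := by
    intro h
    rw [h, zero_div] at hx
    exact x.ne_zero hx.symm
  have hxx : x = Units.mk0 _ ha' / Units.mk0 _ hb' := by
    ext
    simp [hx]
  change f (Additive.ofMul x) = _
  rw [hxx, ofMul_div, map_sub, map_sub, key _ a (by rintro rfl; simp at ha') rfl,
    key _ b (nonZeroDivisors.ne_zero hb) rfl]

end Normalization

/-! ### Local generators of invertible maximal ideals -/

section Generator

variable {O K : Type*} [CommRing O] [Field K] [Algebra O K] [IsFractionRing O K]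

/-- This says that `x` generates `p` locally, with denominators cleared. With `q` the inverse of
`p`, invertibility gives `p ≠ p²`, and any `x` in `p` outside `p²` serves. -/
theorem exists_localization_generator {p : MaximalSpectrum O}
    (hp : IsUnit (p.asIdeal : FractionalIdeal O⁰ K)) :
    ∃ x ∈ p.asIdeal, x ≠ 0 ∧ ∃ s ∉ p.asIdeal, ∀ z ∈ p.asIdeal, s * z ∈ Ideal.span {x} := by
  obtain ⟨q, hq⟩ := hp.exists_right_inv
  have hne : ¬ p.asIdeal ≤ p.asIdeal * p.asIdeal := by
    intro h
    have h' := (FractionalIdeal.coeIdeal_le_coeIdeal K).mpr h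
    have h2 := mul_le_mul_left h' q
    rw [FractionalIdeal.coeIdeal_mul, mul_assoc, hq, mul_one] at h2
    refine p.isMaximal.ne_top (top_le_iff.mp ?_)
    rwa [← FractionalIdeal.coeIdeal_top, FractionalIdeal.coeIdeal_le_coeIdeal] at h2
  obtain ⟨x, hx, hx2⟩ := SetLike.not_le_iff_exists.mp hne
  have hxp : algebraMap O K x ∈ (p.asIdeal : FractionalIdeal O⁰ K) :=
    (FractionalIdeal.mem_coeIdeal _).mpr ⟨x, hx, rfl⟩
  -- If `x q` were contained in `p`, multiplying by `p` would put `x` in `p²`.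
  have hex : ∃ y ∈ q, ∃ s ∉ p.asIdeal, algebraMap O K s = algebraMap O K x * y := by
    by_contra! hcon
    have hle : FractionalIdeal.spanSingleton O⁰ (algebraMap O K x) * q ≤ p.asIdeal := by
      intro w hw
      obtain ⟨y, hy, rfl⟩ := FractionalIdeal.mem_singleton_mul.mp hw
      have h1 := FractionalIdeal.mul_mem_mul hxp hy
      rw [hq] at h1
      obtain ⟨s, hs⟩ := (FractionalIdeal.mem_one_iff _).mp h1
      refine (FractionalIdeal.mem_coeIdeal _).mpr ⟨s, ?_, hs⟩
      by_contra hsp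
      exact hcon y hy s hsp hs
    have h2 := mul_le_mul_left hle (p.asIdeal : FractionalIdeal O⁰ K)
    rw [mul_assoc, mul_comm q, hq, mul_one, ← FractionalIdeal.coeIdeal_mul,
      ← FractionalIdeal.coeIdeal_span_singleton, FractionalIdeal.coeIdeal_le_coeIdeal] at h2
    exact hx2 (h2 (Ideal.mem_span_singleton_self x))
  obtain ⟨y, hy, s, hs, hsy⟩ := hex
  refine ⟨x, hx, ?_, s, hs, fun z hz => ?_⟩
  · rintro rfl
    exact hx2 (zero_mem _)
  -- Here `s z = x (y z)`, and `y z` lies in `q p = O`.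
  · have h1 := FractionalIdeal.mul_mem_mul
      ((FractionalIdeal.mem_coeIdeal (P := K) O⁰).mpr ⟨z, hz, rfl⟩) hy
    rw [hq] at h1
    obtain ⟨r, hr⟩ := (FractionalIdeal.mem_one_iff _).mp h1
    refine Ideal.mem_span_singleton'.mpr ⟨r, IsFractionRing.injective O K ?_⟩
    rw [map_mul, map_mul, hr, hsy]
    ring

theorem exists_localLength_quotient_eq_one {p : MaximalSpectrum O}
    (hp : IsUnit (p.asIdeal : FractionalIdeal O⁰ K)) :
    ∃ x ∈ p.asIdeal, x ≠ 0 ∧ localLength p.asIdeal (O ⧸ Ideal.span {x}) = 1 := by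
  obtain ⟨x, hx, hx0, s, hs, hsz⟩ := exists_localization_generator hp
  refine ⟨x, hx, hx0, ?_⟩
  rw [← localLength_quotient_self p.asIdeal, localLength_quotient, localLength_quotient]
  have h : (Ideal.span {x}).map (algebraMap O (Localization.AtPrime p.asIdeal)) =
      p.asIdeal.map (algebraMap O (Localization.AtPrime p.asIdeal)) := by
    refine le_antisymm (Ideal.map_mono (by simpa [Ideal.span_le] using hx)) ?_
    refine Ideal.map_le_iff_le_comap.mpr fun z hz => ?_
    have hu := IsLocalization.map_units (Localization.AtPrime p.asIdeal)
      (⟨s, hs⟩ : p.asIdeal.primeCompl)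
    rw [Ideal.mem_comap, ← Ideal.unit_mul_mem_iff_mem _ hu]
    rw [← map_mul]
    exact Ideal.mem_map_of_mem _ (hsz z hz)
  rw [h]

end Generator

/-! ### Invertible maximal ideals and their fibres in the normalization -/

section Invertible

variable {O : Type*} [CommRing O] [IsDomain O] [IsNoetherianRing O] [IsOneDimensional O]
variable (K : Type*) [Field K] [Algebra O K] [IsFractionRing O K]

/-- For nonzero `a` in `p`, the ideal `p` is minimal over `(a)`, hence an associated prime of `O /
a`. So `p = ((a) : b)` for some `b`, and `y = b / a` works. -/
theorem exists_mul_mem_range_of_maximal (p : MaximalSpectrum O) :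
    ∃ y : K, y ∉ (algebraMap O K).range ∧
      ∀ z ∈ p.asIdeal, y * algebraMap O K z ∈ (algebraMap O K).range := by
  obtain ⟨a, hap, ha⟩ := Submodule.exists_mem_ne_zero_of_ne_bot (maximal_ne_bot p)
  -- The ideal `(a)` is written as `((a) : 1)`, the shape needed to realize a minimal prime as a
  -- colon ideal.
  have hmin : p.asIdeal ∈ ((Ideal.span {a}).colon {(1 : O)}).minimalPrimes := by
    have h1 : (Ideal.span {a}).colon {(1 : O)} = Ideal.span {a} := by
      ext z
      rw [Submodule.mem_colon_singleton, smul_eq_mul, mul_one]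
    rw [h1]
    refine ⟨⟨p.isMaximal.isPrime, by simpa [Ideal.span_le] using hap⟩, ?_⟩
    rintro q ⟨hq, hqa⟩ hqp
    have hq0 : q ≠ ⊥ := by
      rintro rfl
      exact ha (by simpa using hqa)
    exact ((hq.isMaximal_of_ne_bot hq0).eq_of_le p.isMaximal.ne_top hqp).ge
  obtain ⟨b, hb⟩ := Submodule.exists_eq_colon_of_mem_minimalPrimes hmin
  have ha' : algebraMap O K a ≠ 0 := by simpa using ha
  have hmem : ∀ z : O, z ∈ p.asIdeal ↔ z * b ∈ Ideal.span {a} := fun z => by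
    rw [hb, Submodule.mem_colon_singleton, smul_eq_mul]
  refine ⟨algebraMap O K b / algebraMap O K a, ?_, fun z hz => ?_⟩
  · rintro ⟨r, hr⟩
    refine p.isMaximal.ne_top ((Ideal.eq_top_iff_one _).mpr ((hmem 1).mpr ?_))
    rw [eq_div_iff ha', ← map_mul] at hr
    rw [one_mul, ← IsFractionRing.injective O K hr]
    exact Ideal.mul_mem_left _ _ (Ideal.mem_span_singleton_self a)
  · obtain ⟨r, hr⟩ := Ideal.mem_span_singleton'.mp ((hmem z).mp hz)
    refine ⟨r, ?_⟩
    rw [div_mul_eq_mul_div, eq_div_iff ha', ← map_mul, hr, map_mul, mul_comm]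

/-- Take `y` outside `O` with `y p ⊆ O`. If `y p` is not inside `p`, then `O + y O` is an inverse of
`p`. If `y p ⊆ p`, then `y` is integral, so `c y` lies in `O`; as `c` is invertible modulo `p`, this
forces `y` into `O`. -/
theorem isUnit_of_notMem_conductor {c : O}
    (hc : ∀ s : integralClosure O K, ∃ r : O, algebraMap O (integralClosure O K) r = c • s)
    (p : MaximalSpectrum O) (hcp : c ∉ p.asIdeal) :
    IsUnit (p.asIdeal : FractionalIdeal O⁰ K) := by
  obtain ⟨y, hy, hyp⟩ := exists_mul_mem_range_of_maximal K p
  have hex : ∃ z ∈ p.asIdeal, ∃ r ∉ p.asIdeal, algebraMap O K r = y * algebraMap O K z := by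
    by_contra! hcon
    -- Multiplication by `y` preserves the nonzero finitely generated module `p`.
    have hint : IsIntegral O y := by
      let N : Submodule O K := Submodule.map (Algebra.linearMap O K) p.asIdeal
      refine isIntegral_of_smul_mem_submodule (N := N) ?_ ?_ y ?_
      · intro h
        refine maximal_ne_bot p (Submodule.map_injective_of_injective
          (f := Algebra.linearMap O K) (IsFractionRing.injective O K) ?_)
        rw [Submodule.map_bot]
        exact h
      · exact (IsNoetherian.noetherian p.asIdeal).map _
      · rintro _ ⟨z, hz, rfl⟩
        obtain ⟨r, hr⟩ := hyp z hz
        refine ⟨r, ?_, hr⟩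
        by_contra hrp
        exact hcon z hz r hrp hr
    obtain ⟨r, hr⟩ := hc ⟨y, hint⟩
    have hr' : algebraMap O K r = algebraMap O K c * y := by
      rw [← Algebra.smul_def]
      exact congrArg Subtype.val hr
    -- With `t c + u = 1` and `u` in `p`, both terms of `y = t (c y) + y u` lie in `O`.
    obtain ⟨t, u, hu, htu⟩ := p.isMaximal.exists_inv hcp
    obtain ⟨w, hw⟩ := hyp u hu
    refine hy ⟨t * r + w, ?_⟩
    have h1 := congrArg (algebraMap O K) htu
    rw [map_add, map_mul, map_one] at h1
    rw [map_add, map_mul, hr', hw]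
    linear_combination y * h1
  obtain ⟨z, hz, r, hr, hrz⟩ := hex
  let I : FractionalIdeal O⁰ K := p.asIdeal
  -- The product `p J` is an integral ideal that contains `p` and also `r`, which is not in `p`; by
  -- maximality it is `O`.
  let J : FractionalIdeal O⁰ K := 1 + FractionalIdeal.spanSingleton O⁰ y
  have hIJ : I * J = I + FractionalIdeal.spanSingleton O⁰ y * I := by
    rw [mul_add, mul_one, mul_comm I]
  have hle : I * J ≤ 1 := by
    rw [hIJ]
    refine sup_le FractionalIdeal.coeIdeal_le_one ?_
    intro x hx
    obtain ⟨x', hx', rfl⟩ := FractionalIdeal.mem_singleton_mul.mp hx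
    obtain ⟨z, hz, rfl⟩ := (FractionalIdeal.mem_coeIdeal _).mp hx'
    obtain ⟨r, hr⟩ := hyp z hz
    exact (FractionalIdeal.mem_one_iff _).mpr ⟨r, hr⟩
  obtain ⟨I', hI'⟩ := FractionalIdeal.le_one_iff_exists_coeIdeal.mp hle
  have hpI' : p.asIdeal ≤ I' := by
    rw [← FractionalIdeal.coeIdeal_le_coeIdeal K, hI', hIJ]
    exact le_sup_left
  have hrI' : r ∈ I' := by
    have : algebraMap O K r ∈ (I' : FractionalIdeal O⁰ K) := by
      rw [hI', hIJ, hrz]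
      exact (le_sup_right : FractionalIdeal.spanSingleton O⁰ y * I ≤ _)
        (FractionalIdeal.mem_singleton_mul.mpr
          ⟨_, (FractionalIdeal.mem_coeIdeal _).mpr ⟨z, hz, rfl⟩, rfl⟩)
    obtain ⟨r', hr', h⟩ := (FractionalIdeal.mem_coeIdeal _).mp this
    rwa [← IsFractionRing.injective O K h]
  have htop : I' = ⊤ := by
    by_contra hne
    exact hr (p.isMaximal.eq_of_le hne hpI' ▸ hrI')
  refine IsUnit.of_mul_eq_one J ?_
  rw [← hI', htop, FractionalIdeal.coeIdeal_top]

theorem finite_nonInvertible [Module.Finite O (integralClosure O K)] :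
    Finite (NonInvertible O K) := by
  obtain ⟨c, hc0, hc⟩ := exists_conductor O K
  refine Set.Finite.subset (finite_maximal_mem hc0) fun p hp => ?_
  by_contra hcp
  exact hp (isUnit_of_notMem_conductor K hc p hcp)

variable {K} [Module.Finite O (integralClosure O K)]

/-- For a local generator `x` of `p`, the sum `∑ v_P(x) d_P` over the fibre equals `len (O_p / x) =
1`. Every term is at least 1, so there is a single term and both of its factors are 1. -/
theorem existsUnique_contract_of_isUnit {p : MaximalSpectrum O}
    (hp : IsUnit (p.asIdeal : FractionalIdeal O⁰ K)) :
    ∃ P : MaximalSpectrum (integralClosure O K), contract O P = p ∧ resDeg O P = 1 ∧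
      ∀ P', contract O P' = p → P' = P := by
  obtain ⟨x, hx, hx0, hlen⟩ := exists_localLength_quotient_eq_one hp
  obtain ⟨c, hc0, hc⟩ := exists_conductor O K
  have hunit : ∀ b : O, b ≠ 0 → ((Ideal.span {algebraMap O (integralClosure O K) b} :
      Ideal (integralClosure O K)) : FractionalIdeal (integralClosure O K)⁰ K) ≠ 0 := by
    intro b hb
    rw [Ne, FractionalIdeal.coeIdeal_eq_zero, Ideal.span_singleton_eq_bot]
    simpa using hb
  obtain ⟨m, hm, -⟩ := localLength_quotient_ideal K p _ (Units.mk0 _ (hunit c hc0)) rfl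
  obtain ⟨n, hn, hn'⟩ := localLength_quotient_ideal K p _ (Units.mk0 _ (hunit x hx0)) rfl
  rw [← localLength_quotient_span_algebraMap p.asIdeal hx0 hc (by rw [hm]; exact ENat.natCast_ne_top m),
    hlen] at hn
  obtain rfl : n = 1 := by exact_mod_cast hn.symm
  rw [pushforward_apply] at hn'
  set D := idealDivisor K (Units.mk0 _ (hunit x hx0))
  have hpos : ∀ P : Above (S := integralClosure O K) p, 1 ≤ D P.1 := by
    intro P
    have hle : ((Ideal.span {algebraMap O (integralClosure O K) x} :
      Ideal (integralClosure O K)) : FractionalIdeal (integralClosure O K)⁰ K) ≤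
        P.1.asIdeal := by
      rw [FractionalIdeal.coeIdeal_le_coeIdeal, Ideal.span_singleton_le_iff_mem]
      have : x ∈ (contract O P.1).asIdeal := by rwa [P.2]
      exact this
    have h := FractionalIdeal.count_mono K (toHeightOne _ P.1) (hunit x hx0) hle
    have h2 := FractionalIdeal.count_self K (toHeightOne _ P.1)
    exact h2.ge.trans h
  have hpos' : ∀ P : Above (S := integralClosure O K) p, 1 ≤ D P.1 * resDeg O P.1 := fun P => by
    have := hpos P
    have h2 : (1 : ℤ) ≤ resDeg O P.1 := by exact_mod_cast resDeg_pos O P.1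
    nlinarith
  have hcard : Fintype.card (Above (S := integralClosure O K) p) ≤ 1 := by
    have := Finset.sum_le_sum fun P (_ : P ∈ Finset.univ) => hpos' P
    rw [← hn'] at this
    simp only [Finset.sum_const, Finset.card_univ, nsmul_eq_mul, mul_one] at this
    exact_mod_cast this
  have hsub := Fintype.card_le_one_iff_subsingleton.mp hcard
  -- Over an empty fibre the sum would be 0 rather than 1.
  obtain ⟨P, hP⟩ : Nonempty (Above (S := integralClosure O K) p) := by
    by_contra hne
    have := not_nonempty_iff.mp hne
    simp at hn'
  rw [Fintype.sum_subsingleton _ ⟨P, hP⟩] at hn'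
  refine ⟨P, hP, ?_, fun P' hP' => congrArg Subtype.val (hsub.elim ⟨P', hP'⟩ ⟨P, hP⟩)⟩
  have h1 := hpos ⟨P, hP⟩
  have h2 : (1 : ℤ) ≤ resDeg O P := by exact_mod_cast resDeg_pos O P
  have h3 : (resDeg O P : ℤ) = 1 := by
    simp only [Nat.cast_one] at hn'
    nlinarith
  exact_mod_cast h3

end Invertible

/-! ### Equality of ideal classes -/

section ClassGroup

variable {S : Type*} [CommRing S] [IsDomain S] {K : Type*} [Field K] [Algebra S K]
  [IsFractionRing S K]

theorem _root_.ClassGroup.mk_eq_mk_iff_toPrincipalIdeal {A B : (FractionalIdeal S⁰ K)ˣ} :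
    ClassGroup.mk K A = ClassGroup.mk K B ↔ ∃ x : Kˣ, A = B * toPrincipalIdeal S K x := by
  have h1 : ∀ C : (FractionalIdeal S⁰ K)ˣ,
      ClassGroup.mk K C = 1 ↔ ∃ x : Kˣ, C = toPrincipalIdeal S K x := fun C => by
    rw [ClassGroup.mk_eq_one_iff]
    constructor
    · rintro ⟨x, hx⟩
      have hC : C ∈ (toPrincipalIdeal S K).range := by
        refine mem_principal_ideals_iff.mpr ⟨x, ?_⟩
        rw [← FractionalIdeal.coeToSubmodule_inj, hx, FractionalIdeal.coe_spanSingleton]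
      obtain ⟨y, hy⟩ := hC
      exact ⟨y, hy.symm⟩
    · rintro ⟨x, rfl⟩
      refine ⟨x, ?_⟩
      rw [coe_toPrincipalIdeal, FractionalIdeal.coe_spanSingleton]
  rw [← div_eq_one, ← map_div, h1]
  simp only [div_eq_iff_eq_mul']

end ClassGroup

/-! ### The homomorphism to the Chow group and its kernel -/

section Normalization

variable {O : Type*} [CommRing O] [IsDomain O] [IsNoetherianRing O] [IsOneDimensional O]
variable {K : Type*} [Field K] [Algebra O K] [IsFractionRing O K]
variable [Module.Finite O (integralClosure O K)]

variable (O K) in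
/-- The divisor `∑ a_p p + f_* (div A)` on `O`, for integers `a_p` at the non-invertible maximal
ideals and a fractional ideal `A` of the normalization. -/
noncomputable def divisorOfPair :
    (NonInvertible O K →₀ ℤ) × Additive (FractionalIdeal (integralClosure O K)⁰ K)ˣ →+
      Divisors O :=
  (Finsupp.mapDomain.addMonoidHom Subtype.val).coprod
    ((pushforward O).comp (idealDivisorHom K))

theorem divisorOfPair_apply (a : NonInvertible O K →₀ ℤ)
    (A : (FractionalIdeal (integralClosure O K)⁰ K)ˣ) :
    divisorOfPair O K (a, Additive.ofMul A) =
      Finsupp.mapDomain Subtype.val a + pushforward O (idealDivisor K A) := rfl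

/-- `elemG` as a homomorphism. -/
noncomputable def elemGHom (lam : Coefficients O K) :
    (NonInvertible O K →₀ ℤ) × Additive (FractionalIdeal (integralClosure O K)⁰ K)ˣ →+
      groupG lam :=
  (AddMonoidHom.id _).prodMap
    ((QuotientGroup.mk' (subgroupN lam)).comp (ClassGroup.mk K)).toAdditive

theorem elemGHom_apply (lam : Coefficients O K) (a : NonInvertible O K →₀ ℤ)
    (A : (FractionalIdeal (integralClosure O K)⁰ K)ˣ) :
    elemGHom lam (a, Additive.ofMul A) = elemG lam a A := rfl

theorem elemGHom_surjective (lam : Coefficients O K) : Function.Surjective (elemGHom lam) := by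
  rintro ⟨a, c⟩
  obtain ⟨c, rfl⟩ := Additive.ofMul.surjective c
  obtain ⟨c, rfl⟩ := QuotientGroup.mk_surjective c
  obtain ⟨A, rfl⟩ := ClassGroup.induction K (P := fun c => ∃ A, ClassGroup.mk K A = c)
    (fun A => ⟨A, rfl⟩) c
  exact ⟨(a, Additive.ofMul A), rfl⟩

/-- The prime `P` is alone in its fibre and has degree 1, while the first component is supported at
non-invertible ideals. Thus a pair with zero divisor has no `P` of this kind in its ideal. -/
theorem contract_mem_support_divisorOfPair {P : MaximalSpectrum (integralClosure O K)}
    (hP : IsUnit ((contract O P).asIdeal : FractionalIdeal O⁰ K)) (a : NonInvertible O K →₀ ℤ)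
    (A : (FractionalIdeal (integralClosure O K)⁰ K)ˣ) :
    divisorOfPair O K (a, Additive.ofMul A) (contract O P) = idealDivisor K A P := by
  obtain ⟨P', hP', hdeg, huniq⟩ := existsUnique_contract_of_isUnit hP
  obtain rfl := huniq P rfl
  have hsub : Subsingleton (Above (S := integralClosure O K) (contract O P)) :=
    ⟨fun Q Q' => Subtype.ext ((huniq _ Q.2).trans (huniq _ Q'.2).symm)⟩
  rw [divisorOfPair_apply, Finsupp.add_apply, pushforward_apply,
    Fintype.sum_subsingleton _ ⟨P, rfl⟩, hdeg, Finsupp.mapDomain_of_notMem_range]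
  · simp
  · rintro ⟨p, hp⟩
    exact p.2 (hp ▸ hP)

theorem divisorOfPair_surjective : Function.Surjective (divisorOfPair O K) := by
  rw [← AddMonoidHom.range_eq_top, eq_top_iff]
  intro D _
  rw [← D.sum_single]
  refine AddSubgroup.sum_mem _ fun p _ => ?_
  by_cases hp : IsUnit (p.asIdeal : FractionalIdeal O⁰ K)
  · obtain ⟨P, rfl, hdeg, -⟩ := existsUnique_contract_of_isUnit hp
    refine ⟨(0, D (contract O P) • Additive.ofMul (idealUnit K P)), ?_⟩
    rw [← ofMul_zpow, divisorOfPair_apply, idealDivisor_eq_hom, ofMul_zpow, map_zsmul,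
      ← idealDivisor_eq_hom, idealDivisor_idealUnit, map_zsmul, pushforward_single, hdeg]
    simp
  · exact ⟨(Finsupp.single ⟨p, hp⟩ (D p), Additive.ofMul 1), by
      rw [divisorOfPair_apply, Finsupp.mapDomain_single, idealDivisor_eq_hom, ofMul_one, map_zero,
        map_zero, add_zero]⟩

variable {lam : Coefficients O K}

theorem idealDivisor_idealQ (p : NonInvertible O K) :
    idealDivisor K (idealQ lam p) = ∑ P : Above (S := integralClosure O K) p.1,
      Finsupp.single P.1 (lam p P) := by
  rw [idealDivisor_eq_hom, idealQ, ofMul_prod, map_sum]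
  refine Finset.sum_congr rfl fun P _ => ?_
  rw [ofMul_zpow, map_zsmul, ← idealDivisor_eq_hom, idealDivisor_idealUnit]
  simp

theorem pushforward_idealQ (hlam : ∀ p : NonInvertible O K,
      ∑ P : Above (S := integralClosure O K) p.1, lam p P * (resDeg O P.1 : ℤ) =
        (gcdDeg (integralClosure O K) p.1 : ℤ)) (p : NonInvertible O K) :
    pushforward O (idealDivisor K (idealQ lam p)) =
      Finsupp.single p.1 (gcdDeg (integralClosure O K) p.1 : ℤ) := by
  rw [idealDivisor_idealQ, map_sum, ← hlam, Finsupp.single_finsetSum]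
  refine Finset.sum_congr rfl fun P _ => ?_
  rw [pushforward_single, P.2]

variable (O K) in
/-- The homomorphism sending a fractional ideal `A` of the normalization to the class of
`f_* (div A)`. -/
noncomputable def pushforwardClass :
    Additive (FractionalIdeal (integralClosure O K)⁰ K)ˣ →+ Chow O K :=
  (QuotientAddGroup.mk' _).comp ((pushforward O).comp (idealDivisorHom K))

theorem pushforwardClass_eq_of_mk_eq {A B : (FractionalIdeal (integralClosure O K)⁰ K)ˣ}
    (h : ClassGroup.mk K A = ClassGroup.mk K B) :
    pushforwardClass O K (Additive.ofMul A) = pushforwardClass O K (Additive.ofMul B) := by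
  obtain ⟨x, rfl⟩ := ClassGroup.mk_eq_mk_iff_toPrincipalIdeal.mp h
  have hx : pushforwardClass O K (Additive.ofMul (toPrincipalIdeal _ K x)) = 0 :=
    (QuotientAddGroup.eq_zero_iff _).mpr ⟨Additive.ofMul x, (pushforward_toPrincipalIdeal K x).symm⟩
  rw [ofMul_mul, map_add, hx, add_zero]

/-- On a generator of `N`, the push-forward is already zero as a divisor: `(d_P / g_p) g_p p - d_P p
= 0`. -/
theorem pushforwardClass_eq_zero_of_mem (hlam : ∀ p : NonInvertible O K,
      ∑ P : Above (S := integralClosure O K) p.1, lam p P * (resDeg O P.1 : ℤ) =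
        (gcdDeg (integralClosure O K) p.1 : ℤ))
    {A : (FractionalIdeal (integralClosure O K)⁰ K)ˣ} (h : ClassGroup.mk K A ∈ subgroupN lam) :
    pushforwardClass O K (Additive.ofMul A) = 0 := by
  let H : Subgroup (FractionalIdeal (integralClosure O K)⁰ K)ˣ :=
    AddSubgroup.toSubgroup' (pushforwardClass O K).ker
  -- Membership in `N` concerns classes only, so the argument yields some ideal `B` in the kernel
  -- with the class of `A`; dependence on the class alone then transfers the vanishing to `A`.
  have hle : subgroupN lam ≤ H.map (ClassGroup.mk K) := by
    refine (Subgroup.closure_le _).mpr ?_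
    rintro _ ⟨p, P, rfl⟩
    refine ⟨_, ?_, rfl⟩
    change pushforwardClass O K (Additive.ofMul _) = 0
    have h0 : pushforward O (idealDivisorHom K (Additive.ofMul
      (idealQ lam p ^ (resDeg O P.1 / gcdDeg (integralClosure O K) p.1) *
        (idealUnit K P.1)⁻¹))) = 0 := by
      rw [ofMul_mul, ofMul_pow, ofMul_inv, map_add, map_nsmul, map_neg, map_add, map_nsmul, map_neg,
        ← idealDivisor_eq_hom, ← idealDivisor_eq_hom, pushforward_idealQ hlam,
        idealDivisor_idealUnit, pushforward_single, P.2, one_mul, Finsupp.smul_single, nsmul_eq_mul,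
        ← Nat.cast_mul, gcdDeg_mul_div, add_neg_cancel]
    exact (congrArg (QuotientAddGroup.mk' (principalDivisor O K).range) h0).trans (map_zero _)
  obtain ⟨B, hB, hBA⟩ := hle h
  rw [← pushforwardClass_eq_of_mk_eq hBA]
  exact hB

/-- This is the well-definedness of `φ`, phrased on pairs so that `φ` arises by lifting along
`elemGHom`. -/
theorem elemGHom_ker_le (hlam : ∀ p : NonInvertible O K,
      ∑ P : Above (S := integralClosure O K) p.1, lam p P * (resDeg O P.1 : ℤ) =
        (gcdDeg (integralClosure O K) p.1 : ℤ)) :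
    (elemGHom lam).ker ≤
      ((QuotientAddGroup.mk' (principalDivisor O K).range).comp (divisorOfPair O K)).ker := by
  rintro ⟨a, A⟩ h
  obtain ⟨ha, hA⟩ := Prod.mk_eq_zero.mp h
  change a = 0 at ha
  subst ha
  have hA' : ClassGroup.mk K A.toMul ∈ subgroupN lam := (QuotientGroup.eq_one_iff _).mp hA
  have h1 : divisorOfPair O K (0, A) = pushforward O (idealDivisor K A.toMul) := by
    rw [← ofMul_toMul A, divisorOfPair_apply, Finsupp.mapDomain_zero, zero_add]
    rfl
  exact (congrArg (QuotientAddGroup.mk' (principalDivisor O K).range) h1).trans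
    (pushforwardClass_eq_zero_of_mem hlam hA')

/-- Modulo `N` the class of `P` is that of `Q_p ^ (d_P / g_p)`, so the element is `-(d_P / g_p)`
times a generator of `R`. -/
theorem elemG_idealUnit_mem (p : NonInvertible O K) (P : Above (S := integralClosure O K) p.1) :
    elemG lam (Finsupp.single p (-(resDeg O P.1 : ℤ))) (idealUnit K P.1) ∈ subgroupR lam := by
  have hgen : elemG lam (Finsupp.single p (gcdDeg (integralClosure O K) p.1 : ℤ))
      (idealQ lam p)⁻¹ ∈ subgroupR lam := AddSubgroup.subset_closure ⟨p, rfl⟩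
  have h := (subgroupR lam).neg_mem ((subgroupR lam).nsmul_mem hgen
    (resDeg O P.1 / gcdDeg (integralClosure O K) p.1))
  have hcl : (QuotientGroup.mk (ClassGroup.mk K (idealUnit K P.1)) :
      ClassGroup (integralClosure O K) ⧸ subgroupN lam) = QuotientGroup.mk (ClassGroup.mk K
        (idealQ lam p ^ (resDeg O P.1 / gcdDeg (integralClosure O K) p.1))) := by
    rw [eq_comm, QuotientGroup.eq_iff_div_mem, ← map_div, div_eq_mul_inv]
    exact Subgroup.subset_closure ⟨p, P, rfl⟩
  have hfst : Finsupp.single p (-(resDeg O P.1 : ℤ)) =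
      -((resDeg O P.1 / gcdDeg (integralClosure O K) p.1) •
        Finsupp.single p (gcdDeg (integralClosure O K) p.1 : ℤ)) := by
    rw [Finsupp.smul_single, ← Finsupp.single_neg, nsmul_eq_mul, ← Nat.cast_mul, gcdDeg_mul_div]
  have hsnd : Additive.ofMul (idealQ lam p ^ (resDeg O P.1 / gcdDeg (integralClosure O K) p.1)) =
      -((resDeg O P.1 / gcdDeg (integralClosure O K) p.1) • Additive.ofMul (idealQ lam p)⁻¹) := by
    rw [← ofMul_pow, ← ofMul_inv, inv_pow, inv_inv]
  have h2 : elemG lam (Finsupp.single p (-(resDeg O P.1 : ℤ))) (idealUnit K P.1) =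
      elemGHom lam (Finsupp.single p (-(resDeg O P.1 : ℤ)), Additive.ofMul
        (idealQ lam p ^ (resDeg O P.1 / gcdDeg (integralClosure O K) p.1))) := by
    rw [elemGHom_apply, elemG, hcl, elemG]
  rw [h2, hfst, hsnd, ← Prod.neg_mk, ← Prod.smul_mk, map_neg, map_nsmul, elemGHom_apply]
  exact h

/-- Only primes over non-invertible ideals occur in `A`. Combining the pairs `(-d_P p, P)` with
exponents `v_P(A)` gives a pair with ideal `A`, zero divisor and image in `R`; the vanishing divisor
determines its first component, so it is the given pair. -/
theorem elemGHom_mem_of_divisorOfPair_eq_zero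
    {x : (NonInvertible O K →₀ ℤ) × Additive (FractionalIdeal (integralClosure O K)⁰ K)ˣ}
    (hx : divisorOfPair O K x = 0) : elemGHom lam x ∈ subgroupR lam := by
  obtain ⟨a, A⟩ := x
  -- The first component is forgotten for now, which allows `div A` to be split into its prime
  -- summands.
  have hmem : idealDivisor K A.toMul ∈
      (((subgroupR lam).comap (elemGHom lam)) ⊓ (divisorOfPair O K).ker).map
        ((idealDivisorHom K).comp (AddMonoidHom.snd _ _)) := by
    rw [← (idealDivisor K A.toMul).sum_single]
    refine AddSubgroup.sum_mem _ fun P hP => ?_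
    have hp : ¬ IsUnit ((contract O P).asIdeal : FractionalIdeal O⁰ K) := fun hp => by
      have h := contract_mem_support_divisorOfPair hp a A.toMul
      rw [ofMul_toMul, hx] at h
      exact Finsupp.mem_support_iff.mp hP h.symm
    have h1 : Finsupp.single P 1 ∈
        (((subgroupR lam).comap (elemGHom lam)) ⊓ (divisorOfPair O K).ker).map
          ((idealDivisorHom K).comp (AddMonoidHom.snd _ _)) := by
      refine ⟨(Finsupp.single ⟨_, hp⟩ (-(resDeg O P : ℤ)), Additive.ofMul (idealUnit K P)),
        ⟨elemG_idealUnit_mem ⟨_, hp⟩ ⟨P, rfl⟩, ?_⟩, idealDivisor_idealUnit K P⟩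
      change divisorOfPair O K _ = 0
      rw [divisorOfPair_apply, Finsupp.mapDomain_single, idealDivisor_idealUnit,
        pushforward_single, one_mul, ← Finsupp.single_add, neg_add_cancel, Finsupp.single_zero]
    have h2 := AddSubgroup.zsmul_mem _ h1 (idealDivisor K A.toMul P)
    rwa [Finsupp.smul_single, smul_eq_mul, mul_one] at h2
  obtain ⟨⟨b, B⟩, ⟨hR, hD⟩, hB⟩ := hmem
  obtain rfl : B = A := idealDivisor_injective K hB
  have hab : divisorOfPair O K (b, B) = divisorOfPair O K (a, B) := Eq.trans hD hx.symm
  -- Both pairs have zero divisor and the same ideal, and `ℤ`-combinations of non-invertible maximal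
  -- ideals embed in `Div(O)`.
  obtain rfl : b = a := Finsupp.mapDomain_injective Subtype.val_injective (add_right_cancel hab)
  exact hR

theorem exists_chowHom (hlam : ∀ p : NonInvertible O K,
      ∑ P : Above (S := integralClosure O K) p.1, lam p P * (resDeg O P.1 : ℤ) =
        (gcdDeg (integralClosure O K) p.1 : ℤ)) :
    ∃ φ : groupG lam →+ Chow O K, φ.comp (elemGHom lam) =
      (QuotientAddGroup.mk' (principalDivisor O K).range).comp (divisorOfPair O K) :=
  ⟨(elemGHom lam).liftOfSurjective (elemGHom_surjective lam) ⟨_, elemGHom_ker_le hlam⟩,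
    AddMonoidHom.liftOfRightInverse_comp ..⟩

theorem ker_eq_subgroupR (hlam : ∀ p : NonInvertible O K,
      ∑ P : Above (S := integralClosure O K) p.1, lam p P * (resDeg O P.1 : ℤ) =
        (gcdDeg (integralClosure O K) p.1 : ℤ)) {φ : groupG lam →+ Chow O K}
    (hφ : φ.comp (elemGHom lam) =
      (QuotientAddGroup.mk' (principalDivisor O K).range).comp (divisorOfPair O K)) :
    φ.ker = subgroupR lam := by
  have hφ' := DFunLike.congr_fun hφ
  refine le_antisymm ?_ ((AddSubgroup.closure_le _).mpr ?_)
  · intro y hy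
    obtain ⟨⟨a, A⟩, rfl⟩ := elemGHom_surjective lam y
    obtain ⟨x, hx⟩ := (QuotientAddGroup.eq_zero_iff _).mp ((hφ' (a, A)).symm.trans hy)
    -- The divisor of the pair is the principal divisor of `x`, which is also `f_* (div T)`.
    -- Replacing `A` by `A / T` makes the divisor zero without changing the class.
    let T := toPrincipalIdeal (integralClosure O K) K x.toMul
    have hT : ClassGroup.mk K (A.toMul / T) = ClassGroup.mk K A.toMul :=
      (ClassGroup.mk_eq_mk_iff_toPrincipalIdeal.mpr ⟨x.toMul, by simp [T]⟩).symm
    have h0 : divisorOfPair O K (a, Additive.ofMul (A.toMul / T)) = 0 := by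
      have h1 : divisorOfPair O K (0, Additive.ofMul T) = principalDivisor O K x := by
        rw [divisorOfPair_apply, Finsupp.mapDomain_zero, zero_add]
        exact pushforward_toPrincipalIdeal K x.toMul
      have h2 : (a, Additive.ofMul (A.toMul / T)) = (a, A) - (0, Additive.ofMul T) := by
        rw [Prod.mk_sub_mk, sub_zero, ofMul_div, ofMul_toMul]
      rw [h2, map_sub, h1, hx, sub_self]
    have h3 := elemGHom_mem_of_divisorOfPair_eq_zero (lam := lam) h0
    have h4 : elemGHom lam (a, Additive.ofMul (A.toMul / T)) = elemGHom lam (a, A) := by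
      exact congrArg (fun c => ((a, Additive.ofMul (QuotientGroup.mk c)) : groupG lam)) hT
    rwa [h4] at h3
  · rintro _ ⟨p, rfl⟩
    refine (hφ' (Finsupp.single p _, Additive.ofMul (idealQ lam p)⁻¹)).trans ?_
    have h0 : divisorOfPair O K (Finsupp.single p (gcdDeg (integralClosure O K) p.1 : ℤ),
        Additive.ofMul (idealQ lam p)⁻¹) = 0 := by
      rw [divisorOfPair_apply, Finsupp.mapDomain_single, idealDivisor_eq_hom, ofMul_inv, map_neg,
        map_neg, ← idealDivisor_eq_hom, pushforward_idealQ hlam, add_neg_cancel]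
    exact (congrArg (QuotientAddGroup.mk' (principalDivisor O K).range) h0).trans (map_zero _)

end Normalization

end OneDimDomain

theorem theorem2p10 (O : Type*) [CommRing O] [IsDomain O] [IsNoetherianRing O]
    [IsOneDimensional O] (K : Type*) [Field K] [Algebra O K] [IsFractionRing O K]
    [Module.Finite O (integralClosure O K)]
    (lam : OneDimDomain.Coefficients O K)
    (hlam : ∀ p : OneDimDomain.NonInvertible O K,
      ∑ P : OneDimDomain.Above (S := integralClosure O K) p.1,
        lam p P * (OneDimDomain.resDeg O P.1 : ℤ) =
          (OneDimDomain.gcdDeg (integralClosure O K) p.1 : ℤ)) :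
    Finite (OneDimDomain.NonInvertible O K) ∧
    ∃ φ : OneDimDomain.groupG lam →+ OneDimDomain.Chow O K,
      (∀ (a : OneDimDomain.NonInvertible O K →₀ ℤ)
        (A : (FractionalIdeal (nonZeroDivisors (integralClosure O K)) K)ˣ),
        φ (OneDimDomain.elemG lam a A) =
          QuotientAddGroup.mk (Finsupp.mapDomain Subtype.val a +
            OneDimDomain.pushforward O (OneDimDomain.idealDivisor K A))) ∧
      Function.Surjective φ ∧
      φ.ker = OneDimDomain.subgroupR lam ∧
      Nonempty (OneDimDomain.groupG lam ⧸ OneDimDomain.subgroupR lam ≃+ OneDimDomain.Chow O K) := by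
  obtain ⟨φ, hφ⟩ := OneDimDomain.exists_chowHom hlam
  have hker := OneDimDomain.ker_eq_subgroupR hlam hφ
  have hsurj : Function.Surjective φ := by
    refine Function.Surjective.of_comp (g := OneDimDomain.elemGHom lam) ?_
    rw [← AddMonoidHom.coe_comp, hφ]
    exact (QuotientAddGroup.mk'_surjective _).comp OneDimDomain.divisorOfPair_surjective
  exact ⟨OneDimDomain.finite_nonInvertible K, φ,
    fun a A => DFunLike.congr_fun hφ (a, Additive.ofMul A), hsurj, hker,
    ⟨(QuotientAddGroup.quotientAddEquivOfEq hker.symm).trans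
      (QuotientAddGroup.quotientKerEquivOfSurjective φ hsurj)⟩⟩
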